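/- All graphs are finite and simple. A marked permutation graph is a pair $(G,M)$ in which $G$ is a cubic graph and $M$ is a perfect matching of $G$ such that $G-E(M)$ is the disjoint union of two cycles, neither of which has a chord in $G$. An $M$-copy of the $4$-cycle is a $4$-cycle in $G$ that uses two edges of $M$. An $M$-copy of the Petersen graph is a subgraph of $G$ that is isomorphic to a subdivision of the Petersen graph and is composed of the two cycles of $G-E(M)$ together with five edges of $M$. Proposition. If $(G,M)$ is a marked permutation graph with $n\ge 40$ vertices and $G$ contains no $M$-copy of the $4$-cycle, then $G$ contains at least $n/2-4$ distinct $M$-copies of the Petersen graph. -/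

import Mathlib

/-- The Petersen graph: its vertices are the 2-element subsets of a 5-element set, two of them being
adjacent when they are disjoint. -/
def petersenGraph : SimpleGraph {s : Finset (Fin 5) // s.card = 2} where
  Adj s t := Disjoint s.1 t.1
  symm := ⟨fun _ _ h => h.symm⟩
  loopless := ⟨fun s h => by
    have h1 : s.1 = ∅ := by simpa using h
    have h2 := s.2
    rw [h1] at h2
    simp at h2⟩

/-- `H` is isomorphic to a subdivision of `P`: the vertices of `P` are sent injectively to branch
vertices of `H`, each edge of `P` to a path of `H` between the corresponding branch vertices (the same
path, reversed, for the reversed edge), the paths are pairwise internally disjoint and have no branch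
vertex in their interior, and `H` has no other vertices and edges than those of this system. -/
def IsSubdivisionOf {W U : Type*} (H : SimpleGraph U) (P : SimpleGraph W) : Prop :=
  ∃ (branch : W ↪ U) (path : ∀ a b : W, P.Adj a b → H.Walk (branch a) (branch b)),
    (∀ a b (h : P.Adj a b), (path a b h).IsPath) ∧
    (∀ a b (h : P.Adj a b), path b a h.symm = (path a b h).reverse) ∧
    (∀ a b (h : P.Adj a b) (w : W), branch w ∈ (path a b h).support → w = a ∨ w = b) ∧
    (∀ a b (h : P.Adj a b) c d (h' : P.Adj c d), s(a, b) ≠ s(c, d) →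
      ∀ x ∈ (path a b h).support, x ∈ (path c d h').support → x ∈ Set.range branch) ∧
    (∀ x : U, x ∈ Set.range branch ∨ ∃ a b, ∃ h : P.Adj a b, x ∈ (path a b h).support) ∧
    (∀ e ∈ H.edgeSet, ∃ a b, ∃ h : P.Adj a b, e ∈ (path a b h).edges)

/-- The subgraph `C` is a cycle of `G`. -/
def IsCycleSubgraph {V : Type*} {G : SimpleGraph V} (C : G.Subgraph) : Prop :=
  ∃ k : ℕ, 3 ≤ k ∧ Nonempty (SimpleGraph.cycleGraph k ≃g C.coe)

/-- `(G, M)` is a marked permutation graph: `G` is cubic, and `M` is a perfect matching of `G` such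
that `G - E(M)` is the disjoint union of two cycles `C` and `D`, none of which has a chord in `G`. -/
def IsMarkedPermutationGraph {V : Type*} (G : SimpleGraph V) [G.LocallyFinite]
    (M : G.Subgraph) : Prop :=
  G.IsRegularOfDegree 3 ∧ M.IsPerfectMatching ∧
    ∃ C D : (G.deleteEdges M.edgeSet).Subgraph,
      IsCycleSubgraph C ∧ IsCycleSubgraph D ∧ Disjoint C.verts D.verts ∧ C ⊔ D = ⊤ ∧
      (∀ u ∈ C.verts, ∀ v ∈ C.verts, G.Adj u v → C.Adj u v) ∧
      (∀ u ∈ D.verts, ∀ v ∈ D.verts, G.Adj u v → D.Adj u v)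

/-- `Q` is an `M`-copy of the 4-cycle: a 4-cycle of `G` using two edges of `M`. -/
def IsMCopyOfC4 {V : Type*} {G : SimpleGraph V} (M Q : G.Subgraph) : Prop :=
  Nonempty (SimpleGraph.cycleGraph 4 ≃g Q.coe) ∧ (Q.edgeSet ∩ M.edgeSet).ncard = 2

/-- `Q` is an `M`-copy of the Petersen graph: a subgraph of `G` that is isomorphic to a subdivision of
the Petersen graph and is composed of `G - E(M)` (all vertices of `G` and all edges outside `M`)
together with five edges of `M`. -/
def IsMCopyOfPetersen {V : Type*} {G : SimpleGraph V} (M Q : G.Subgraph) : Prop :=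
  IsSubdivisionOf Q.coe petersenGraph ∧ Q.verts = Set.univ ∧
    ∃ X : Set (Sym2 V), X ⊆ M.edgeSet ∧ X.ncard = 5 ∧ Q.edgeSet = (G.edgeSet \ M.edgeSet) ∪ X

/-! With `m = n/2`, number the two cycles as `f` and `g` so that the matching joins `f i` to `g (β
i)`, where `β` permutes `[0, m)` and `β 0 = 0`. Five matching edges give a Petersen subdivision when
their ends, taken in cyclic order along one cycle, occur in star-pentagon order along the other: a
pentagram of `β`. So it is enough to find `m - 4` pentagrams.

Existence (`exists_isPentagramSet`): the point `0` together with a pattern 2413 or 3142 on `[1, m)`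
is a pentagram. If neither pattern occurs, then `β` is separable on `[1, m)`, and a separable
permutation of at least two points has neighbouring points with neighbouring values
(`exists_consecutive_of_forall_not_pattern`). Two such matching edges close up to an `M`-copy of the
4-cycle, which is excluded.

Multiplication (`IsPentagramSet.exchange`): given a pentagram `S`, each of the `m - 5` other points
`x` lies in a pentagram formed by `x` and four points of `S`. These are distinct for distinct `x`,
and `S` itself is one more. Different pentagrams use different matching edges, hence give different
subgraphs. -/

/-! ### Permutations avoiding 2413 and 3142 -/

/-- If the values of `σ` on the window `[s, e)` are never separated by a value at a point of the
window `[lo, hi)` outside it, and `σ` contains no pattern `2413` or `3142`, then the window contains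
two consecutive points between whose values no other value occurs. -/
theorem exists_consecutive_of_forall_not_pattern {α : Type*} [LinearOrder α] (k : ℕ) :
    ∀ {lo hi s e : ℕ} {σ : ℕ → α}, Set.InjOn σ (Set.Ico lo hi) →
    (∀ a b c d, lo ≤ a → a < b → b < c → c < d → d < hi →
      σ c < σ a → σ a < σ d → σ d < σ b → False) →
    (∀ a b c d, lo ≤ a → a < b → b < c → c < d → d < hi →
      σ b < σ d → σ d < σ a → σ a < σ c → False) →
    e - s ≤ k → lo ≤ s → s + 2 ≤ e → e ≤ hi →
    (∀ y, lo ≤ y → y < hi → (y < s ∨ e ≤ y) →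
      (∀ i, s ≤ i → i < e → σ y < σ i) ∨ (∀ i, s ≤ i → i < e → σ i < σ y)) →
    ∃ i, lo ≤ i ∧ i + 1 < hi ∧ ∀ y, lo ≤ y → y < hi →
      ¬ (σ i < σ y ∧ σ y < σ (i + 1)) ∧ ¬ (σ (i + 1) < σ y ∧ σ y < σ i) := by
  induction k generalizing α with
  | zero => intros; omega
  | succ k ih =>
    -- the case in which the second value of the window is above the first one
    have key : ∀ {β : Type _} [LinearOrder β] {lo hi s e : ℕ} {σ : ℕ → β},
        Set.InjOn σ (Set.Ico lo hi) →
        (∀ a b c d, lo ≤ a → a < b → b < c → c < d → d < hi →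
          σ c < σ a → σ a < σ d → σ d < σ b → False) →
        (∀ a b c d, lo ≤ a → a < b → b < c → c < d → d < hi →
          σ b < σ d → σ d < σ a → σ a < σ c → False) →
        e - s ≤ k + 1 → lo ≤ s → s + 2 ≤ e → e ≤ hi →
        (∀ y, lo ≤ y → y < hi → (y < s ∨ e ≤ y) →
          (∀ i, s ≤ i → i < e → σ y < σ i) ∨ (∀ i, s ≤ i → i < e → σ i < σ y)) →
        σ s < σ (s + 1) →
        ∃ i, lo ≤ i ∧ i + 1 < hi ∧ ∀ y, lo ≤ y → y < hi →
          ¬ (σ i < σ y ∧ σ y < σ (i + 1)) ∧ ¬ (σ (i + 1) < σ y ∧ σ y < σ i) := by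
      intro β _ lo hi s e σ hinj h1 h2 hk hlo hse hhi hmod hup
      -- the first run `[s + 1, r)` of values above `σ s`
      have hex : ∃ r, s + 1 < r ∧ (r = e ∨ (r < e ∧ σ r < σ s)) := ⟨e, by omega, Or.inl rfl⟩
      classical
      let r := Nat.find hex
      obtain ⟨hr1, hr2⟩ : s + 1 < r ∧ (r = e ∨ (r < e ∧ σ r < σ s)) := Nat.find_spec hex
      have hre : r ≤ e := by rcases hr2 with h | h <;> omega
      have hrun : ∀ i, s < i → i < r → σ s < σ i := by
        intro i hi1 hi2
        rcases eq_or_ne i (s + 1) with rfl | hne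
        · exact hup
        have := Nat.find_min hex hi2
        have h3 : ¬ σ i < σ s := fun h => this ⟨by omega, Or.inr ⟨by omega, h⟩⟩
        refine lt_of_le_of_ne (not_lt.1 h3) fun h => ?_
        have := hinj ⟨hlo, by omega⟩ ⟨by omega, by omega⟩ h
        omega
      -- A later value above `σ s` but below some `σ i` of the run would make `s, i, r, y` a pattern
      -- 2413. Hence no value outside the run separates it, and the run is a shorter window of the
      -- same kind.
      have hafter : ∀ y, r ≤ y → y < e → σ s < σ y → ∀ i, s < i → i < r → σ i < σ y := by
        intro y hy1 hy2 hy3 i hi1 hi2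
        have hr3 : r < e ∧ σ r < σ s := by
          rcases hr2 with h | h
          · omega
          · exact h
        have hry : r ≠ y := by rintro h; rw [← h] at hy3; exact lt_asymm hy3 hr3.2
        refine lt_of_not_ge fun h => ?_
        have hlt : σ y < σ i := lt_of_le_of_ne h fun h => by
          have := hinj ⟨by omega, by omega⟩ ⟨by omega, by omega⟩ h
          omega
        exact h1 s i r y hlo hi1 hi2 (by omega) (by omega) hr3.2 hy3 hlt
      have hmod' : ∀ y, lo ≤ y → y < hi → (y < s + 1 ∨ r ≤ y) →
          (∀ i, s + 1 ≤ i → i < r → σ y < σ i) ∨ (∀ i, s + 1 ≤ i → i < r → σ i < σ y) := by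
        intro y hy1 hy2 hy3
        by_cases hys : y < s ∨ e ≤ y
        · rcases hmod y hy1 hy2 hys with h | h
          · exact Or.inl fun i hi1 hi2 => h i (by omega) (by omega)
          · exact Or.inr fun i hi1 hi2 => h i (by omega) (by omega)
        rcases eq_or_ne y s with rfl | hne
        · exact Or.inl fun i hi1 hi2 => hrun i (by omega) hi2
        rcases lt_or_ge (σ s) (σ y) with h | h
        · exact Or.inr fun i hi1 hi2 => hafter y (by omega) (by omega) h i (by omega) hi2
        · exact Or.inl fun i hi1 hi2 => lt_of_le_of_lt h (hrun i (by omega) hi2)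
      -- A run of one point gives the pair `s, s + 1` directly; a longer run is handled by
      -- induction.
      rcases Nat.lt_or_ge r (s + 3) with hr3 | hr3
      · refine ⟨s, hlo, by omega, fun y hy1 hy2 => ⟨?_, fun h => lt_asymm hup (h.1.trans h.2)⟩⟩
        rintro ⟨ha, hb⟩
        by_cases hys : y < s ∨ e ≤ y
        · rcases hmod y hy1 hy2 hys with h | h
          · exact lt_asymm ha (h s le_rfl (by omega))
          · exact lt_asymm hb (h (s + 1) (by omega) (by omega))
        have hy3 : y ≠ s := by rintro rfl; exact lt_irrefl _ ha
        have hy4 : y ≠ s + 1 := by rintro rfl; exact lt_irrefl _ hb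
        exact lt_asymm hb (hafter y (by omega) (by omega) ha (s + 1) (by omega) (by omega))
      · exact ih hinj h1 h2 (by omega) (by omega) (by omega) (by omega) hmod'
    intro lo hi s e σ hinj h1 h2 hk hlo hse hhi hmod
    rcases lt_trichotomy (σ s) (σ (s + 1)) with h | h | h
    · exact key hinj h1 h2 hk hlo hse hhi hmod h
    · have := hinj ⟨hlo, by omega⟩ ⟨by omega, by omega⟩ h
      omega
    -- Reversing the order of the values exchanges 2413 and 3142, so the two avoidance hypotheses
    -- trade places.
    · obtain ⟨i, hi1, hi2, hi3⟩ := key (σ := fun i => OrderDual.toDual (σ i))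
        (fun a ha b hb hab => hinj ha hb hab)
        (fun a b c d ha hb hc hd he p q r => h2 a b c d ha hb hc hd he r q p)
        (fun a b c d ha hb hc hd he p q r => h1 a b c d ha hb hc hd he r q p)
        hk hlo hse hhi (fun y hy1 hy2 hy3 => (hmod y hy1 hy2 hy3).symm) h
      exact ⟨i, hi1, hi2, fun y hy1 hy2 =>
        ⟨fun h => (hi3 y hy1 hy2).2 ⟨h.2, h.1⟩, fun h => (hi3 y hy1 hy2).1 ⟨h.2, h.1⟩⟩⟩

/-! ### Cyclic orders and pentagrams -/

/-- The five numbers occur in this cyclic order. -/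
def CyclicallyOrdered (a b c d e : ℕ) : Prop :=
  (a < b ∧ b < c ∧ c < d ∧ d < e) ∨ (b < c ∧ c < d ∧ d < e ∧ e < a) ∨
  (c < d ∧ d < e ∧ e < a ∧ a < b) ∨ (d < e ∧ e < a ∧ a < b ∧ b < c) ∨
  (e < a ∧ a < b ∧ b < c ∧ c < d)

theorem CyclicallyOrdered.rotate {a b c d e : ℕ} (h : CyclicallyOrdered a b c d e) :
    CyclicallyOrdered b c d e a := by
  unfold CyclicallyOrdered at *; tauto

/-- The six numbers occur in this cyclic order. -/
def CyclicallyOrderedSix (a b c d e f : ℕ) : Prop :=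
  (a < b ∧ b < c ∧ c < d ∧ d < e ∧ e < f) ∨ (b < c ∧ c < d ∧ d < e ∧ e < f ∧ f < a) ∨
  (c < d ∧ d < e ∧ e < f ∧ f < a ∧ a < b) ∨ (d < e ∧ e < f ∧ f < a ∧ a < b ∧ b < c) ∨
  (e < f ∧ f < a ∧ a < b ∧ b < c ∧ c < d) ∨ (f < a ∧ a < b ∧ b < c ∧ c < d ∧ d < e)

theorem CyclicallyOrderedSix.rotate {a b c d e f : ℕ} (h : CyclicallyOrderedSix a b c d e f) :
    CyclicallyOrderedSix b c d e f a := by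
  unfold CyclicallyOrderedSix at *; tauto

theorem CyclicallyOrderedSix.drop {a b c d e f : ℕ} (h : CyclicallyOrderedSix a b c d e f) :
    CyclicallyOrdered b c d e f := by
  unfold CyclicallyOrderedSix at h
  unfold CyclicallyOrdered
  omega

theorem CyclicallyOrdered.insert {a b c d e x : ℕ} (h : CyclicallyOrdered a b c d e)
    (ha : x ≠ a) (hb : x ≠ b) (hc : x ≠ c) (hd : x ≠ d) (he : x ≠ e) :
    CyclicallyOrderedSix a x b c d e ∨ CyclicallyOrderedSix b x c d e a ∨
    CyclicallyOrderedSix c x d e a b ∨ CyclicallyOrderedSix d x e a b c ∨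
    CyclicallyOrderedSix e x a b c d := by
  have sorted : ∀ {a b c d e : ℕ}, a < b ∧ b < c ∧ c < d ∧ d < e → x ≠ a → x ≠ b → x ≠ c →
      x ≠ d → x ≠ e →
      CyclicallyOrderedSix a x b c d e ∨ CyclicallyOrderedSix b x c d e a ∨
      CyclicallyOrderedSix c x d e a b ∨ CyclicallyOrderedSix d x e a b c ∨
      CyclicallyOrderedSix e x a b c d := by
    intro a b c d e h ha hb hc hd he
    have h6 : x < a ∨ (a < x ∧ x < b) ∨ (b < x ∧ x < c) ∨ (c < x ∧ x < d) ∨ (d < x ∧ x < e) ∨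
      e < x := by omega
    unfold CyclicallyOrderedSix
    rcases h6 with h6 | h6 | h6 | h6 | h6 | h6 <;> simp only [h, h6, true_and, true_or, or_true]
  rcases h with h | h | h | h | h
  · exact sorted h ha hb hc hd he
  · have := sorted h hb hc hd he ha; tauto
  · have := sorted h hc hd he ha hb; tauto
  · have := sorted h hd he ha hb hc; tauto
  · have := sorted h he ha hb hc hd; tauto

/-- The five points of a permutation `β` form a pentagram: the cyclic order of their values is the
one of the star pentagon, in one of the two directions. -/
def IsPentagram (β : ℕ → ℕ) (a b c d e : ℕ) : Prop :=
  CyclicallyOrdered a b c d e ∧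
    (CyclicallyOrdered (β a) (β c) (β e) (β b) (β d) ∨
      CyclicallyOrdered (β a) (β d) (β b) (β e) (β c))

theorem IsPentagram.rotate {β : ℕ → ℕ} {a b c d e : ℕ} (h : IsPentagram β a b c d e) :
    IsPentagram β b c d e a :=
  ⟨h.1.rotate, h.2.imp (fun h => h.rotate.rotate.rotate) (fun h => h.rotate.rotate)⟩

/-- If `β x` falls in a gap next to `β a` or `β b`, then `x` takes the place of that point, being
its neighbour in position as well as in value. The only other gap lies between `β c` and `β e`;
there `x` replaces the opposite point `d`, and the star order changes direction. This is why both
directions are allowed in `IsPentagram`. -/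
theorem IsPentagram.exchange_of_mem_arc {β : ℕ → ℕ} {a b c d e x : ℕ}
    (h : IsPentagram β a b c d e) (hx : CyclicallyOrderedSix a x b c d e)
    (ha : β x ≠ β a) (hb : β x ≠ β b) (hc : β x ≠ β c) (hd : β x ≠ β d) (he : β x ≠ β e) :
    IsPentagram β x b c d e ∨ IsPentagram β a x c d e ∨ IsPentagram β a x b c e := by
  have h1 : CyclicallyOrdered x b c d e := hx.drop
  have h2 : CyclicallyOrdered a x c d e := hx.rotate.rotate.drop.rotate.rotate.rotate
  have h3 : CyclicallyOrdered a x b c e := hx.rotate.rotate.rotate.rotate.drop.rotate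
  rcases h.2 with h | h
  · rcases h.insert ha hc he hb hd with h | h | h | h | h
    · exact Or.inl ⟨h1, Or.inl h.drop⟩
    · exact Or.inr (Or.inr ⟨h3, Or.inr h.rotate.rotate.rotate.rotate.drop⟩)
    · exact Or.inr (Or.inl ⟨h2, Or.inl h.rotate.rotate.drop.rotate⟩)
    · exact Or.inr (Or.inl ⟨h2, Or.inl h.drop.rotate.rotate⟩)
    · exact Or.inl ⟨h1, Or.inl h.rotate.rotate.drop.rotate.rotate.rotate.rotate⟩
  · rcases h.insert ha hd hb he hc with h | h | h | h | h
    · exact Or.inl ⟨h1, Or.inr h.drop⟩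
    · exact Or.inr (Or.inl ⟨h2, Or.inr h.rotate.rotate.drop.rotate.rotate⟩)
    · exact Or.inr (Or.inl ⟨h2, Or.inr h.drop.rotate.rotate.rotate⟩)
    · exact Or.inr (Or.inr ⟨h3, Or.inl h.rotate.rotate.rotate.rotate.drop.rotate.rotate.rotate.rotate⟩)
    · exact Or.inl ⟨h1, Or.inr h.rotate.rotate.drop.rotate.rotate.rotate.rotate⟩

/-- The points of `S` form a pentagram of `β`. -/
def IsPentagramSet (β : ℕ → ℕ) (S : Finset ℕ) : Prop :=
  ∃ a b c d e, S = {a, b, c, d, e} ∧ IsPentagram β a b c d e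

/-- Every further point forms a pentagram with four of the five points of a given one. -/
theorem IsPentagramSet.exchange {β : ℕ → ℕ} {S : Finset ℕ} (hS : IsPentagramSet β S) {x : ℕ}
    (hx : ∀ y ∈ S, β x ≠ β y) : ∃ T, IsPentagramSet β T ∧ x ∈ T ∧ T ⊆ insert x S := by
  obtain ⟨a, b, c, d, e, rfl, h⟩ := hS
  have key : ∀ {a b c d e : ℕ}, IsPentagram β a b c d e → CyclicallyOrderedSix a x b c d e →
      (∀ y ∈ ({a, b, c, d, e} : Finset ℕ), β x ≠ β y) →
      ∃ T, IsPentagramSet β T ∧ x ∈ T ∧ T ⊆ insert x {a, b, c, d, e} := by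
    intro a b c d e h h1 hx
    simp only [Finset.mem_insert, Finset.mem_singleton, forall_eq_or_imp, forall_eq] at hx
    obtain ⟨ha, hb, hc, hd, he⟩ := hx
    rcases h.exchange_of_mem_arc h1 ha hb hc hd he with h | h | h
    · refine ⟨_, ⟨_, _, _, _, _, rfl, h⟩, by simp, fun y => ?_⟩
      simp only [Finset.mem_insert, Finset.mem_singleton]; tauto
    · refine ⟨_, ⟨_, _, _, _, _, rfl, h⟩, by simp, fun y => ?_⟩
      simp only [Finset.mem_insert, Finset.mem_singleton]; tauto
    · refine ⟨_, ⟨_, _, _, _, _, rfl, h⟩, by simp, fun y => ?_⟩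
      simp only [Finset.mem_insert, Finset.mem_singleton]; tauto
  have rot : ∀ a b c d e : ℕ, ({a, b, c, d, e} : Finset ℕ) = {b, c, d, e, a} := by
    intro a b c d e
    ext y
    simp only [Finset.mem_insert, Finset.mem_singleton]; tauto
  have hne : ∀ y ∈ ({a, b, c, d, e} : Finset ℕ), x ≠ y := fun y hy hxy => hx y hy (by rw [hxy])
  simp only [Finset.mem_insert, Finset.mem_singleton, forall_eq_or_imp, forall_eq] at hne
  obtain ⟨ha, hb, hc, hd, he⟩ := hne
  rcases h.1.insert ha hb hc hd he with g | g | g | g | g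
  · exact key h g hx
  · rw [rot] at hx ⊢
    exact key h.rotate g hx
  · rw [rot, rot] at hx ⊢
    exact key h.rotate.rotate g hx
  · rw [rot, rot, rot] at hx ⊢
    exact key h.rotate.rotate.rotate g hx
  · rw [rot, rot, rot, rot] at hx ⊢
    exact key h.rotate.rotate.rotate.rotate g hx

theorem IsPentagramSet.card {β : ℕ → ℕ} {S : Finset ℕ} (hS : IsPentagramSet β S) : S.card = 5 := by
  obtain ⟨a, b, c, d, e, rfl, h, -⟩ := hS
  have : a ≠ b ∧ a ≠ c ∧ a ≠ d ∧ a ≠ e ∧ b ≠ c ∧ b ≠ d ∧ b ≠ e ∧ c ≠ d ∧ c ≠ e ∧ d ≠ e := by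
    unfold CyclicallyOrdered at h; omega
  obtain ⟨h1, h2, h3, h4, h5, h6, h7, h8, h9, h10⟩ := this
  simp [*]

/-- A permutation of `[0, m)` with a pentagram has at least `m - 4` of them. -/
theorem IsPentagramSet.exists_family {β : ℕ → ℕ} {m : ℕ} {S : Finset ℕ}
    (hβ : Set.InjOn β (Set.Iio m)) (hS : IsPentagramSet β S) (hSm : S ⊆ Finset.range m) :
    ∃ F : Finset (Finset ℕ), m - 4 ≤ F.card ∧
      ∀ T ∈ F, IsPentagramSet β T ∧ T ⊆ Finset.range m := by
  have hex : ∀ x ∈ Finset.range m \ S, ∃ T, IsPentagramSet β T ∧ x ∈ T ∧ T ⊆ insert x S := by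
    intro x hx
    simp only [Finset.mem_sdiff, Finset.mem_range] at hx
    refine hS.exchange fun y hy hxy => hx.2 ?_
    rw [hβ hx.1 (Finset.mem_range.1 (hSm hy)) hxy]
    exact hy
  choose! T hT1 hT2 hT3 using hex
  -- `x` is the only element of `T x` outside `S`, so `T x` determines `x`.
  have hinj : Set.InjOn T (Finset.range m \ S : Finset ℕ) := by
    intro x hx y hy hxy
    have h := hT3 y hy (hxy ▸ hT2 x hx)
    simp only [Finset.coe_sdiff, Set.mem_sdiff, Finset.mem_coe] at hx
    simpa [hx.2] using h
  refine ⟨insert S ((Finset.range m \ S).image T), ?_, ?_⟩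
  · rw [Finset.card_insert_of_notMem, Finset.card_image_of_injOn hinj,
      Finset.card_sdiff_of_subset hSm, Finset.card_range, hS.card]
    · omega
    · intro h
      obtain ⟨x, hx, hxS⟩ := Finset.mem_image.1 h
      exact (Finset.mem_sdiff.1 hx).2 (hxS ▸ hT2 x hx)
  · intro U hU
    rcases Finset.mem_insert.1 hU with rfl | hU
    · exact ⟨hS, hSm⟩
    · obtain ⟨x, hx, rfl⟩ := Finset.mem_image.1 hU
      refine ⟨hT1 x hx, (hT3 x hx).trans ?_⟩
      exact Finset.insert_subset (Finset.mem_sdiff.1 hx).1 hSm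

/-- A permutation of `[0, m)` fixing `0` in which no two consecutive points have consecutive values
has a pentagram. -/
theorem exists_isPentagramSet {β : ℕ → ℕ} {m : ℕ} (hm : 3 ≤ m)
    (hβ : Set.BijOn β (Set.Iio m) (Set.Iio m)) (h0 : β 0 = 0)
    (hcons : ∀ i, i + 1 < m → β (i + 1) ≠ β i + 1 ∧ β i ≠ β (i + 1) + 1) :
    ∃ S, IsPentagramSet β S ∧ S ⊆ Finset.range m := by
  have hpos : ∀ i, 1 ≤ i → i < m → 0 < β i := fun i h1 h2 => Nat.pos_of_ne_zero fun h => by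
    have := hβ.injOn (show i < m from h2) (show 0 < m by omega) (h.trans h0.symm)
    omega
  by_contra hno
  obtain ⟨i, hi1, hi2, hi3⟩ := exists_consecutive_of_forall_not_pattern m
    (lo := 1) (hi := m) (s := 1) (e := m) (σ := β)
    (hβ.injOn.mono fun i hi => hi.2)
    (by
      intro a b c d ha hab hbc hcd hd h1 h2 h3
      have := hpos c (by omega) (by omega)
      -- A smallest value placed in front of 2413 gives 02413, whose cyclic order of values is a
      -- star; 03142 below is the star in the other direction.
      refine hno ⟨{0, a, b, c, d}, ⟨0, a, b, c, d, rfl, ?_, Or.inr ?_⟩, fun y => ?_⟩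
      · exact Or.inl (by omega)
      · exact Or.inl (by omega)
      · simp only [Finset.mem_insert, Finset.mem_singleton, Finset.mem_range]; omega)
    (by
      intro a b c d ha hab hbc hcd hd h1 h2 h3
      have := hpos b (by omega) (by omega)
      refine hno ⟨{0, a, b, c, d}, ⟨0, a, b, c, d, rfl, ?_, Or.inl ?_⟩, fun y => ?_⟩
      · exact Or.inl (by omega)
      · exact Or.inl (by omega)
      · simp only [Finset.mem_insert, Finset.mem_singleton, Finset.mem_range]; omega)
    -- The window is the whole of `[1, m)`, so the separation condition is vacuous.
    (by omega) le_rfl (by omega) le_rfl (fun y h1 h2 h3 => by omega)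
  have hne : β i ≠ β (i + 1) := fun h => by
    have := hβ.injOn (show i < m by omega) (show i + 1 < m from hi2) h
    omega
  have hlt1 : β i < m := hβ.mapsTo (show i < m by omega)
  have hlt2 : β (i + 1) < m := hβ.mapsTo (show i + 1 < m from hi2)
  have hc := hcons i hi2
  have hp1 := hpos i hi1 (by omega)
  have hp2 := hpos (i + 1) (by omega) (by omega)
  -- The two values differ by at least two, so the successor of the smaller one lies strictly
  -- between them; it is positive, hence taken at a point of `[1, m)`.
  obtain ⟨y, hy, hyv⟩ := hβ.surjOn (show min (β i) (β (i + 1)) + 1 < m by omega)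
  have hy0 : y ≠ 0 := by rintro rfl; omega
  have := hi3 y (by omega) hy
  omega

/-! ### Subdivisions and paths along a cycle -/

open SimpleGraph in
/-- To show that `H` is a subdivision of `P` it is enough to give the path of each edge of `P` in one
direction. -/
theorem IsSubdivisionOf.of_orientation {U W : Type*} {H : SimpleGraph U} {P : SimpleGraph W}
    (R : W → W → Prop) (hR : ∀ a b, R a b → ¬ R b a)
    (hP : ∀ a b, P.Adj a b ↔ R a b ∨ R b a) (br : W ↪ U)
    (p : ∀ a b, R a b → H.Walk (br a) (br b)) (hpath : ∀ a b h, (p a b h).IsPath)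
    (hbr : ∀ a b h w, br w ∈ (p a b h).support → w = a ∨ w = b)
    (hdisj : ∀ a b h c d h', (a, b) ≠ (c, d) →
      ∀ x ∈ (p a b h).support, x ∈ (p c d h').support → x ∈ Set.range br)
    (hedge : ∀ u v, H.Adj u v → ∃ a b h, s(u, v) ∈ (p a b h).edges)
    (hcov : ∀ u, ∃ v, H.Adj u v) :
    IsSubdivisionOf H P := by
  classical
  have hP' : ∀ a b, P.Adj a b → ¬ R a b → R b a := by
    intro a b h h'
    have := (hP a b).1 h
    tauto
  have hPe : ∀ a b, R a b → P.Adj a b := fun a b h => (hP a b).2 (Or.inl h)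
  -- Asymmetry of `R` makes exactly one direction of each edge primary; the other direction gets the
  -- reversed path.
  let path : ∀ a b, P.Adj a b → H.Walk (br a) (br b) := fun a b h =>
    if h' : R a b then p _ _ h' else (p _ _ (hP' a b h h')).reverse
  have hpos : ∀ a b (h : P.Adj a b) (h' : R a b), path a b h = p _ _ h' :=
    fun a b h h' => dif_pos h'
  have hneg : ∀ a b (h : P.Adj a b) (h' : R b a), path a b h = (p _ _ h').reverse :=
    fun a b h h' => dif_neg (hR _ _ h')
  have hcase : ∀ a b (h : P.Adj a b), (∃ h' : R a b, path a b h = p _ _ h') ∨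
      (∃ h' : R b a, path a b h = (p _ _ h').reverse) := by
    intro a b h
    by_cases h' : R a b
    · exact Or.inl ⟨h', hpos a b h h'⟩
    · exact Or.inr ⟨hP' a b h h', hneg a b h _⟩
  have hsupp : ∀ a b (h : P.Adj a b), ∃ c d, ∃ h' : R c d, s(a, b) = s(c, d) ∧
      ∀ x, x ∈ (path a b h).support ↔ x ∈ (p c d h').support := by
    intro a b h
    rcases hcase a b h with ⟨h', h2⟩ | ⟨h', h2⟩
    · exact ⟨_, _, h', rfl, by simp [h2]⟩
    · exact ⟨_, _, h', Sym2.eq_swap, by simp [h2]⟩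
  refine ⟨br, path, ?_, ?_, ?_, ?_, ?_, ?_⟩
  · intro a b h
    rcases hcase a b h with ⟨h', h2⟩ | ⟨h', h2⟩
    · rw [h2]; exact hpath _ _ _
    · rw [h2]; exact (hpath _ _ _).reverse
  · intro a b h
    rcases hcase a b h with ⟨h', h2⟩ | ⟨h', h2⟩
    · rw [h2, hneg b a h.symm h']
    · rw [h2, hpos b a h.symm h', Walk.reverse_reverse]
  · intro a b h w hw
    obtain ⟨c, d, h', h2, h3⟩ := hsupp a b h
    have h4 : w ∈ s(a, b) := by rw [h2]; exact Sym2.mem_iff.2 (hbr c d h' w ((h3 _).1 hw))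
    exact Sym2.mem_iff.1 h4
  · intro a b h c d h' hne x hx hx'
    obtain ⟨a1, b1, h1, h2, h3⟩ := hsupp a b h
    obtain ⟨c1, d1, h4, h5, h6⟩ := hsupp c d h'
    exact hdisj a1 b1 h1 c1 d1 h4
      (fun hh => hne (by rw [h2, h5, (Prod.mk.inj hh).1, (Prod.mk.inj hh).2])) x
      ((h3 x).1 hx) ((h6 x).1 hx')
  · intro x
    right
    -- No vertex is isolated, so covering the edges covers the vertices.
    obtain ⟨v, hv⟩ := hcov x
    obtain ⟨a, b, h, hx⟩ := hedge x v hv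
    exact ⟨a, b, hPe a b h, hpos a b (hPe a b h) h ▸ Walk.fst_mem_support_of_mem_edges _ hx⟩
  · intro x hx
    induction x with | _ u v
    obtain ⟨a, b, h, hx⟩ := hedge u v hx
    exact ⟨a, b, hPe a b h, hpos a b (hPe a b h) h ▸ hx⟩

theorem SimpleGraph.exists_walk_of_sequence {U : Type*} {H : SimpleGraph U} {f : ℕ → U}
    (hf : ∀ n, H.Adj (f n) (f (n + 1))) (s l : ℕ) :
    ∃ w : H.Walk (f s) (f (s + l)), w.support = (List.range (l + 1)).map (fun j => f (s + j)) ∧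
      w.edges = (List.range l).map (fun j => s(f (s + j), f (s + j + 1))) := by
  induction l with
  | zero => exact ⟨Walk.nil, by simp, by simp⟩
  | succ l ih =>
    obtain ⟨w, h1, h2⟩ := ih
    refine ⟨w.concat (hf (s + l)), ?_, ?_⟩
    · rw [Walk.support_concat, h1, List.range_succ (n := l + 1), List.map_append]
      simp
    · rw [Walk.edges_concat, h2, List.range_succ (n := l), List.map_append]
      simp [add_assoc]

/-- Turns equality of vertices on a cycle into equality of indices within one closed turn; the
exceptional cases are the start and end of the turn, which are the same vertex. -/
theorem Nat.ModEq.eq_or_of_mem_Icc {m A n k : ℕ} (h : n ≡ k [MOD m]) (hn : A ≤ n)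
    (hn' : n ≤ A + m) (hk : A ≤ k) (hk' : k ≤ A + m) :
    n = k ∨ (n = A ∧ k = A + m) ∨ (n = A + m ∧ k = A) := by
  have key : ∀ {n k : ℕ}, n ≡ k [MOD m] → A ≤ n → k ≤ A + m → n ≤ k →
      n = k ∨ (n = A ∧ k = A + m) := by
    intro n k h hn hk hnk
    have hd := (Nat.modEq_iff_dvd' hnk).1 h
    rcases Nat.eq_zero_or_pos (k - n) with h0 | h0
    · left; omega
    · have := Nat.le_of_dvd h0 hd
      right; omega
  rcases le_total n k with h' | h'
  · have := key h hn hk' h'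
    tauto
  · have := key h.symm hk hn' h'
    omega

theorem Nat.exists_modEq_mem_Ico {m : ℕ} (hm : 0 < m) (A n : ℕ) :
    ∃ k, A ≤ k ∧ k < A + m ∧ k ≡ n [MOD m] := by
  refine ⟨A + (n + (m - A % m)) % m, by omega, by have := Nat.mod_lt (n + (m - A % m)) hm; omega, ?_⟩
  have h1 : A + (n + (m - A % m)) = n + m * (A / m + 1) := by
    have := Nat.div_add_mod A m
    have := Nat.mod_lt A hm
    rw [mul_add]; omega
  calc A + (n + (m - A % m)) % m ≡ A + (n + (m - A % m)) [MOD m] :=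
        Nat.ModEq.add_left _ (Nat.mod_modEq _ _)
    _ = n + m * (A / m + 1) := h1
    _ ≡ n [MOD m] := by simp [Nat.ModEq]

/-- Five points of a cycle, in cyclic order, divide it into five internally disjoint paths. -/
theorem SimpleGraph.exists_walks_of_cyclic_sequence {U : Type*} {H : SimpleGraph U} {f : ℕ → U}
    {m : ℕ} (hf : ∀ n, H.Adj (f n) (f (n + 1))) (hper : ∀ i j, f i = f j ↔ i ≡ j [MOD m])
    {a : Fin 5 → ℕ} (h01 : a 0 < a 1) (h12 : a 1 < a 2) (h23 : a 2 < a 3) (h34 : a 3 < a 4)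
    (h40 : a 4 < a 0 + m) {br : Fin 5 → U} (hbr : ∀ i, br i = f (a i)) :
    ∃ w : ∀ i, H.Walk (br i) (br (i + 1)), (∀ i, (w i).IsPath) ∧
      (∀ i j, br j ∈ (w i).support → j = i ∨ j = i + 1) ∧
      (∀ i j, i ≠ j → ∀ x ∈ (w i).support, x ∈ (w j).support → x ∈ Set.range br) ∧
      (∀ n, ∃ i, s(f n, f (n + 1)) ∈ (w i).edges) ∧
      (∀ i, ∀ x ∈ (w i).support, x ∈ Set.range f) := by
  have hm : 0 < m := by omega
  -- The last segment ends at `a 0 + m`, not at `a 0`, so that all five segments are intervals of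
  -- indices tiling one turn.
  let nx : Fin 5 → ℕ := ![a 1, a 2, a 3, a 4, a 0 + m]
  have nx0 : nx 0 = a 1 := rfl
  have nx1 : nx 1 = a 2 := rfl
  have nx2 : nx 2 = a 3 := rfl
  have nx3 : nx 3 = a 4 := rfl
  have nx4 : nx 4 = a 0 + m := rfl
  have hfive : ∀ i : Fin 5, i = 0 ∨ i = 1 ∨ i = 2 ∨ i = 3 ∨ i = 4 := by decide
  have hlt : ∀ i, a i < nx i ∧ nx i < a i + m ∧ a 0 ≤ a i ∧ nx i ≤ a 0 + m := by
    intro i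
    fin_cases i <;> simp [nx] <;> omega
  have hnx : ∀ i, br (i + 1) = f (nx i) := by
    intro i
    rw [hbr, hper]
    fin_cases i <;> simp [nx, Nat.ModEq]
  have hseg : ∀ i, ∃ w : H.Walk (br i) (br (i + 1)), w.IsPath ∧
      (∀ x, x ∈ w.support → ∃ n, a i ≤ n ∧ n ≤ nx i ∧ x = f n) ∧
      (∀ n, a i ≤ n → n < nx i → s(f n, f (n + 1)) ∈ w.edges) := by
    intro i
    rw [hbr i, hnx i]
    obtain ⟨h1, h2, h3, h4⟩ := hlt i
    obtain ⟨l, hl⟩ := Nat.exists_eq_add_of_lt h1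
    rw [add_assoc] at hl
    obtain ⟨w, hw, hw'⟩ := exists_walk_of_sequence hf (a i) (l + 1)
    rw [hl] at h2 h4 ⊢
    refine ⟨w, ?_, ?_, ?_⟩
    · rw [Walk.isPath_def, hw]
      refine List.Nodup.map_on (fun j hj k hk hjk => ?_) List.nodup_range
      rw [List.mem_range] at hj hk
      rw [hper] at hjk
      have := hjk.eq_or_of_mem_Icc (A := a i) (by omega) (by omega) (by omega) (by omega)
      omega
    · intro x hx
      rw [hw, List.mem_map] at hx
      obtain ⟨j, hj, rfl⟩ := hx
      rw [List.mem_range] at hj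
      exact ⟨a i + j, by omega, by omega, rfl⟩
    · intro n hn1 hn2
      rw [hw', List.mem_map]
      refine ⟨n - a i, List.mem_range.2 (by omega), ?_⟩
      rw [show a i + (n - a i) = n by omega]
  choose w hw1 hw2 hw3 using hseg
  refine ⟨w, hw1, ?_, ?_, ?_, ?_⟩
  · intro i j hj
    obtain ⟨n, h1, h2, h3⟩ := hw2 i _ hj
    rw [hbr, hper] at h3
    have hi := hlt i
    have hj := hlt j
    have := h3.eq_or_of_mem_Icc (A := a 0) (by omega) (by omega) (by omega) (by omega)
    clear h3
    rcases hfive i with rfl | rfl | rfl | rfl | rfl <;>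
    rcases hfive j with rfl | rfl | rfl | rfl | rfl <;>
    first
    | decide
    | (exfalso; simp only [nx0, nx1, nx2, nx3, nx4] at h2; omega)
  · intro i j hij x hx hx'
    obtain ⟨n, h1, h2, rfl⟩ := hw2 i _ hx
    obtain ⟨k, h3, h4, h5⟩ := hw2 j _ hx'
    rw [hper] at h5
    have hi := hlt i
    have hj := hlt j
    have := h5.eq_or_of_mem_Icc (A := a 0) (by omega) (by omega) (by omega) (by omega)
    -- The intervals overlap only at end points, so a vertex shared by two segments is a branch
    -- vertex.
    have hn : n = a 0 ∨ n = a 1 ∨ n = a 2 ∨ n = a 3 ∨ n = a 4 ∨ n = a 0 + m := by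
      clear h5 hx hx'
      rcases hfive i with rfl | rfl | rfl | rfl | rfl <;>
      rcases hfive j with rfl | rfl | rfl | rfl | rfl <;>
      first
      | exact absurd rfl hij
      | (simp only [nx0, nx1, nx2, nx3, nx4] at h2 h4; omega)
    rcases hn with rfl | rfl | rfl | rfl | rfl | rfl
    exacts [⟨0, hbr 0⟩, ⟨1, hbr 1⟩, ⟨2, hbr 2⟩, ⟨3, hbr 3⟩, ⟨4, hbr 4⟩,
      ⟨0, by rw [hbr, hper]; simp [Nat.ModEq]⟩]
  · intro n
    obtain ⟨k, h1, h2, h3⟩ := Nat.exists_modEq_mem_Ico hm (a 0) n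
    have e1 : f n = f k := ((hper _ _).2 h3).symm
    have e2 : f (n + 1) = f (k + 1) := ((hper _ _).2 (h3.add_right 1)).symm
    rw [e1, e2]
    have : ∃ i, a i ≤ k ∧ k < nx i := by
      have : (a 0 ≤ k ∧ k < a 1) ∨ (a 1 ≤ k ∧ k < a 2) ∨ (a 2 ≤ k ∧ k < a 3) ∨
        (a 3 ≤ k ∧ k < a 4) ∨ (a 4 ≤ k ∧ k < a 0 + m) := by omega
      rcases this with h | h | h | h | h
      exacts [⟨0, h⟩, ⟨1, h⟩, ⟨2, h⟩, ⟨3, h⟩, ⟨4, h⟩]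
    obtain ⟨i, hi1, hi2⟩ := this
    exact ⟨i, hw3 i k hi1 hi2⟩
  · intro i x hx
    obtain ⟨n, -, -, rfl⟩ := hw2 i x hx
    exact ⟨n, rfl⟩

/-! ### The Petersen graph as two 5-cycles with spokes -/

/-- An orientation of the Petersen graph drawn as two 5-cycles joined by five spokes; the `j`-th
vertex of the second cycle is joined to the vertex `t * j` of the first one. -/
def PetersenArc (t : Fin 5) : Fin 5 ⊕ Fin 5 → Fin 5 ⊕ Fin 5 → Prop
  | .inl i, .inl j => j = i + 1
  | .inr i, .inr j => j = i + 1
  | .inl i, .inr j => i = t * j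
  | .inr _, .inl _ => False

instance (t : Fin 5) : DecidableRel (PetersenArc t) := fun a b => by
  cases a <;> cases b <;> unfold PetersenArc <;> infer_instance

/-- The two cycles of `PetersenArc t`, as cycles of pairs. -/
def petersenVertex (t : Fin 5) : Fin 5 ⊕ Fin 5 → {s : Finset (Fin 5) // s.card = 2}
  | .inl i => ⟨{2 * i, 2 * i + 1}, by revert i; decide⟩
  | .inr j => ⟨{2 * t * j + 4, 2 * t * j + 2}, by revert t j; decide⟩

instance : DecidableRel petersenGraph.Adj := fun a b =>
  inferInstanceAs (Decidable (Disjoint a.1 b.1))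

theorem petersenVertex_bijective {t : Fin 5} (ht : t = 2 ∨ t = 3) :
    Function.Bijective (petersenVertex t) := by
  rcases ht with rfl | rfl <;> decide

/-- Modulo 5, the pairs `{2i, 2i+1}` form a 5-cycle under disjointness, and the third neighbour of
`{2i, 2i+1}` is `{2i+4, 2i+2}`. These third neighbours form a 5-cycle when `i` advances by 2 or by
3, that is, along `i = t * j`. -/
theorem petersenGraph_adj_petersenVertex {t : Fin 5} (ht : t = 2 ∨ t = 3) :
    ∀ a b, petersenGraph.Adj (petersenVertex t a) (petersenVertex t b) ↔
      PetersenArc t a b ∨ PetersenArc t b a := by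
  rcases ht with rfl | rfl <;> decide

theorem PetersenArc.asymm (t : Fin 5) : ∀ a b, PetersenArc t a b → ¬ PetersenArc t b a := by
  revert t; decide

open SimpleGraph in
/-- Two cycles joined by five spokes form a subdivision of the Petersen graph if the spokes have on
the cycles the cyclic orders of a pentagon and a star pentagon. -/
theorem isSubdivisionOf_petersenGraph {U : Type*} {H : SimpleGraph U} {f g : ℕ → U} {m : ℕ}
    (hf : ∀ n, H.Adj (f n) (f (n + 1))) (hfper : ∀ i j, f i = f j ↔ i ≡ j [MOD m])
    (hg : ∀ n, H.Adj (g n) (g (n + 1))) (hgper : ∀ i j, g i = g j ↔ i ≡ j [MOD m])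
    (hfg : ∀ i j, f i ≠ g j) (hcov : ∀ u, (∃ n, u = f n) ∨ ∃ n, u = g n)
    {a b : Fin 5 → ℕ} (ha : a 0 < a 1 ∧ a 1 < a 2 ∧ a 2 < a 3 ∧ a 3 < a 4 ∧ a 4 < a 0 + m)
    (hb : b 0 < b 1 ∧ b 1 < b 2 ∧ b 2 < b 3 ∧ b 3 < b 4 ∧ b 4 < b 0 + m)
    {t : Fin 5} (ht : t = 2 ∨ t = 3) (hspoke : ∀ j, H.Adj (f (a (t * j))) (g (b j)))
    (hedge : ∀ u v, H.Adj u v → (∃ n, s(u, v) = s(f n, f (n + 1))) ∨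
      (∃ n, s(u, v) = s(g n, g (n + 1))) ∨ ∃ j, s(u, v) = s(f (a (t * j)), g (b j))) :
    IsSubdivisionOf H petersenGraph := by
  obtain ⟨wf, wf1, wf2, wf3, wf4, wf5⟩ := SimpleGraph.exists_walks_of_cyclic_sequence hf hfper
    ha.1 ha.2.1 ha.2.2.1 ha.2.2.2.1 ha.2.2.2.2 (br := fun i => f (a i)) fun _ => rfl
  obtain ⟨wg, wg1, wg2, wg3, wg4, wg5⟩ := SimpleGraph.exists_walks_of_cyclic_sequence hg hgper
    hb.1 hb.2.1 hb.2.2.1 hb.2.2.2.1 hb.2.2.2.2 (br := fun i => g (b i)) fun _ => rfl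
  have hinj : ∀ {a : Fin 5 → ℕ} {h : ℕ → U}, (∀ i j, h i = h j ↔ i ≡ j [MOD m]) →
      (a 0 < a 1 ∧ a 1 < a 2 ∧ a 2 < a 3 ∧ a 3 < a 4 ∧ a 4 < a 0 + m) →
      ∀ i j, h (a i) = h (a j) → i = j := by
    intro a h hh ha i j hij
    rw [hh] at hij
    have hfive : ∀ i : Fin 5, i = 0 ∨ i = 1 ∨ i = 2 ∨ i = 3 ∨ i = 4 := by decide
    have hi : a 0 ≤ a i ∧ a i < a 0 + m := by
      rcases hfive i with rfl | rfl | rfl | rfl | rfl <;> omega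
    have hj : a 0 ≤ a j ∧ a j < a 0 + m := by
      rcases hfive j with rfl | rfl | rfl | rfl | rfl <;> omega
    have := hij.eq_or_of_mem_Icc (A := a 0) (by omega) (by omega) (by omega) (by omega)
    rcases hfive i with rfl | rfl | rfl | rfl | rfl <;>
    rcases hfive j with rfl | rfl | rfl | rfl | rfl <;>
    first
    | rfl
    | omega
  let br' : Fin 5 ⊕ Fin 5 → U := Sum.elim (fun i => f (a i)) (fun i => g (b i))
  have hbr' : Function.Injective br' := by
    rintro (i | i) (j | j) hij
    · rw [hinj hfper ha i j hij]
    · exact absurd hij (hfg _ _)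
    · exact absurd hij.symm (hfg _ _)
    · rw [hinj hgper hb i j hij]
  let p : ∀ x y, PetersenArc t x y → H.Walk (br' x) (br' y) := fun
    | .inl i, .inl _, h => (wf i).copy rfl (congrArg (fun k => f (a k)) h.symm)
    | .inr i, .inr _, h => (wg i).copy rfl (congrArg (fun k => g (b k)) h.symm)
    | .inl _, .inr j, h => ((hspoke j).toWalk).copy (congrArg (fun k => f (a k)) h.symm) rfl
    | .inr _, .inl _, h => h.elim
  have hpp : ∀ x y h, (p x y h).IsPath ∧ ∀ z, br' z ∈ (p x y h).support → z = x ∨ z = y := by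
    rintro (i | i) (j | j) h
    · obtain rfl : j = i + 1 := h
      refine ⟨wf1 i, ?_⟩
      rintro (k | k) hz
      · rcases wf2 i k hz with rfl | rfl
        exacts [Or.inl rfl, Or.inr rfl]
      · obtain ⟨n, hn⟩ := wf5 i _ hz
        exact absurd hn (hfg _ _)
    · obtain rfl : i = t * j := h
      refine ⟨Walk.IsPath.of_adj (hspoke j), fun z hz => ?_⟩
      have hz' : br' z ∈ [br' (.inl (t * j)), br' (.inr j)] := hz
      simp only [List.mem_cons, List.not_mem_nil, or_false] at hz'
      exact hz'.imp (fun h => hbr' h) (fun h => hbr' h)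
    · exact h.elim
    · obtain rfl : j = i + 1 := h
      refine ⟨wg1 i, ?_⟩
      rintro (k | k) hz
      · obtain ⟨n, hn⟩ := wg5 i _ hz
        exact absurd hn.symm (hfg _ _)
      · rcases wg2 i k hz with rfl | rfl
        exacts [Or.inl rfl, Or.inr rfl]
  have hspk : ∀ i j (h : PetersenArc t (.inl i) (.inr j)), ∀ x ∈ (p _ _ h).support,
      x ∈ Set.range br' := by
    intro i j h x hx
    obtain rfl : i = t * j := h
    have hx' : x ∈ [br' (.inl (t * j)), br' (.inr j)] := hx
    simp only [List.mem_cons, List.not_mem_nil, or_false] at hx'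
    rcases hx' with rfl | rfl
    exacts [⟨_, rfl⟩, ⟨_, rfl⟩]
  have hdisj : ∀ x y h x' y' h', (x, y) ≠ (x', y') → ∀ u ∈ (p x y h).support,
      u ∈ (p x' y' h').support → u ∈ Set.range br' := by
    rintro (i | i) (j | j) h (i' | i') (j' | j') h' hne u hu hu'
    all_goals first
      | exact h.elim
      | exact h'.elim
      | exact hspk _ _ h u hu
      | exact hspk _ _ h' u hu'
      | skip
    · obtain rfl : j = i + 1 := h
      obtain rfl : j' = i' + 1 := h'
      obtain ⟨k, hk⟩ := wf3 i i' (by rintro rfl; exact hne rfl) u hu hu'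
      exact ⟨.inl k, hk⟩
    · obtain rfl : j = i + 1 := h
      obtain rfl : j' = i' + 1 := h'
      obtain ⟨n, rfl⟩ := wf5 i u hu
      obtain ⟨k, hk⟩ := wg5 i' _ hu'
      exact absurd hk.symm (hfg _ _)
    · obtain rfl : j = i + 1 := h
      obtain rfl : j' = i' + 1 := h'
      obtain ⟨n, rfl⟩ := wg5 i u hu
      obtain ⟨k, hk⟩ := wf5 i' _ hu'
      exact absurd hk (hfg _ _)
    · obtain rfl : j = i + 1 := h
      obtain rfl : j' = i' + 1 := h'
      obtain ⟨k, hk⟩ := wg3 i i' (by rintro rfl; exact hne rfl) u hu hu'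
      exact ⟨.inr k, hk⟩
  have hedge' : ∀ u v, H.Adj u v → ∃ x y h, s(u, v) ∈ (p x y h).edges := by
    intro u v huv
    rcases hedge u v huv with ⟨n, hn⟩ | ⟨n, hn⟩ | ⟨j, hj⟩
    · obtain ⟨i, hi⟩ := wf4 n
      exact ⟨.inl i, .inl (i + 1), rfl, hn ▸ hi⟩
    · obtain ⟨i, hi⟩ := wg4 n
      exact ⟨.inr i, .inr (i + 1), rfl, hn ▸ hi⟩
    · refine ⟨.inl (t * j), .inr j, rfl, hj ▸ ?_⟩
      change s(f (a (t * j)), g (b j)) ∈ [s(f (a (t * j)), g (b j))]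
      simp
  let e := Equiv.ofBijective _ (petersenVertex_bijective ht)
  refine IsSubdivisionOf.of_orientation (fun w w' => PetersenArc t (e.symm w) (e.symm w'))
    (fun w w' => PetersenArc.asymm t _ _) (fun w w' => ?_)
    ⟨fun w => br' (e.symm w), hbr'.comp e.symm.injective⟩ (fun w w' h => p _ _ h)
    (fun w w' h => (hpp _ _ h).1) (fun w w' h z hz => ?_) (fun w w' h z z' h' hne u hu hu' => ?_)
    (fun u v huv => ?_) (fun u => ?_)
  · rw [← petersenGraph_adj_petersenVertex ht]
    change _ ↔ petersenGraph.Adj (e (e.symm w)) (e (e.symm w'))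
    simp
  · exact ((hpp _ _ h).2 _ hz).imp (fun h => e.symm.injective h) (fun h => e.symm.injective h)
  · obtain ⟨x, hx⟩ := hdisj _ _ h _ _ h' (fun hh => hne (by
      rw [e.symm.injective (Prod.mk.inj hh).1, e.symm.injective (Prod.mk.inj hh).2])) u hu hu'
    exact ⟨e x, by simpa using hx⟩
  · obtain ⟨x, y, h, hxy⟩ := hedge' u v huv
    obtain ⟨x, rfl⟩ := e.symm.surjective x
    obtain ⟨y, rfl⟩ := e.symm.surjective y
    exact ⟨x, y, h, hxy⟩
  · rcases hcov u with ⟨n, rfl⟩ | ⟨n, rfl⟩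
    exacts [⟨_, hf n⟩, ⟨_, hg n⟩]

/-! ### From marked graphs to permutations -/

/-- The enumeration `f` runs through the vertices of `C` along a cycle of length `m`, over and over. -/
def IsCyclicEnumeration {V : Type*} {G : SimpleGraph V} (C : G.Subgraph) (m : ℕ) (f : ℕ → V) :
    Prop :=
  (∀ i j, f i = f j ↔ i ≡ j [MOD m]) ∧ (∀ v, v ∈ C.verts ↔ ∃ n, v = f n) ∧
    ∀ u v, C.Adj u v ↔ ∃ n, s(u, v) = s(f n, f (n + 1))

theorem IsCycleSubgraph.exists_isCyclicEnumeration {V : Type*} {G : SimpleGraph V}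
    {C : G.Subgraph} (hC : IsCycleSubgraph C) :
    ∃ m f, 3 ≤ m ∧ IsCyclicEnumeration C m f := by
  obtain ⟨k, hk, ⟨e⟩⟩ := hC
  obtain ⟨k, rfl⟩ := Nat.exists_eq_add_of_le' hk
  have hadd : ∀ n : ℕ, (Fin.ofNat (k + 3) (n + 1)) = Fin.ofNat (k + 3) n + 1 := by
    intro n
    ext
    simp [Fin.val_add]
  have hsurj : ∀ i : Fin (k + 3), Fin.ofNat (k + 3) i.1 = i := by
    intro i; ext; simp
  refine ⟨k + 3, fun n => (e (Fin.ofNat (k + 3) n)).1, hk, ?_, ?_, ?_⟩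
  · intro i j
    rw [Subtype.val_inj, e.injective.eq_iff, Fin.ext_iff]
    rfl
  · intro v
    constructor
    · intro hv
      obtain ⟨i, hi⟩ := e.surjective ⟨v, hv⟩
      exact ⟨i.1, by simp only [hsurj, hi]⟩
    · rintro ⟨n, rfl⟩
      exact (e _).2
  · intro u v
    have hadj : ∀ i j : Fin (k + 3), C.Adj (e i).1 (e j).1 ↔ j = i + 1 ∨ i = j + 1 := by
      intro i j
      rw [← SimpleGraph.Subgraph.coe_adj, e.map_adj_iff, SimpleGraph.cycleGraph_adj,
        sub_eq_iff_eq_add', sub_eq_iff_eq_add', or_comm]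
    constructor
    · intro huv
      obtain ⟨i, hi⟩ := e.surjective ⟨u, C.edge_vert huv⟩
      obtain ⟨j, hj⟩ := e.surjective ⟨v, C.edge_vert huv.symm⟩
      obtain rfl : (e i).1 = u := by rw [hi]
      obtain rfl : (e j).1 = v := by rw [hj]
      rcases (hadj i j).1 huv with rfl | rfl
      · exact ⟨i.1, by simp only [hadd, hsurj]⟩
      · exact ⟨j.1, by simp only [hadd, hsurj]; exact Sym2.eq_swap⟩
    · rintro ⟨n, hn⟩
      have h := (hadj (Fin.ofNat (k + 3) n) (Fin.ofNat (k + 3) (n + 1))).2 (Or.inl (hadd n))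
      rcases Sym2.eq_iff.1 hn with ⟨rfl, rfl⟩ | ⟨rfl, rfl⟩
      exacts [h, h.symm]

theorem IsCyclicEnumeration.shift {V : Type*} {G : SimpleGraph V} {C : G.Subgraph} {m : ℕ}
    {f : ℕ → V} (hf : IsCyclicEnumeration C m f) (hm : 0 < m) (s : ℕ) :
    IsCyclicEnumeration C m (fun n => f (n + s)) := by
  obtain ⟨h1, h2, h3⟩ := hf
  have hsurj : ∀ n, ∃ k, ∀ j, f (n + j) = f (k + s + j) := by
    intro n
    -- The representative is chosen at least `s`, so that the subtraction `k - s` is not truncated.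
    obtain ⟨k, hk, -, hk'⟩ := Nat.exists_modEq_mem_Ico hm s n
    refine ⟨k - s, fun j => (h1 _ _).2 ?_⟩
    rw [Nat.sub_add_cancel hk]
    exact hk'.symm.add_right j
  refine ⟨fun i j => ?_, fun v => ?_, fun u v => ?_⟩
  · rw [h1]
    exact ⟨fun h => h.add_right_cancel', fun h => h.add_right s⟩
  · rw [h2]
    constructor
    · rintro ⟨n, rfl⟩
      obtain ⟨k, hk⟩ := hsurj n
      exact ⟨k, hk 0⟩
    · rintro ⟨n, rfl⟩
      exact ⟨_, rfl⟩
  · rw [h3]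
    constructor
    · rintro ⟨n, hn⟩
      obtain ⟨k, hk⟩ := hsurj n
      refine ⟨k, ?_⟩
      have e : k + 1 + s = k + s + 1 := by omega
      have h0 : f n = f (k + s) := hk 0
      simp only [hn, hk 1, h0, e]
    · rintro ⟨n, hn⟩
      refine ⟨n + s, ?_⟩
      have e : n + 1 + s = n + s + 1 := by omega
      simp only [hn, e]

theorem IsCyclicEnumeration.exists_lt {V : Type*} {G : SimpleGraph V} {C : G.Subgraph} {m : ℕ}
    {f : ℕ → V} (hf : IsCyclicEnumeration C m f) (hm : 0 < m) {v : V} (hv : v ∈ C.verts) :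
    ∃ n < m, v = f n := by
  obtain ⟨n, rfl⟩ := (hf.2.1 v).1 hv
  exact ⟨n % m, Nat.mod_lt _ hm, (hf.1 _ _).2 (Nat.mod_modEq _ _).symm⟩

theorem IsCyclicEnumeration.injOn {V : Type*} {G : SimpleGraph V} {C : G.Subgraph} {m : ℕ}
    {f : ℕ → V} (hf : IsCyclicEnumeration C m f) {i j : ℕ} (hi : i < m) (hj : j < m)
    (h : f i = f j) : i = j :=
  Nat.ModEq.eq_of_lt_of_lt ((hf.1 _ _).1 h) hi hj

/-- The marked graph `(G, M)` consists of two chordless cycles `f` and `g` of length `m` and the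
matching of `f i` with `g (β i)`, where `β` is a permutation of `[0, m)` fixing `0`. -/
structure IsPermutationPresentation {V : Type*} {G : SimpleGraph V} (M : G.Subgraph) (m : ℕ)
    (f g : ℕ → V) (β : ℕ → ℕ) : Prop where
  three_le : 3 ≤ m
  fst_eq_iff : ∀ i j, f i = f j ↔ i ≡ j [MOD m]
  snd_eq_iff : ∀ i j, g i = g j ↔ i ≡ j [MOD m]
  fst_ne_snd : ∀ i j, f i ≠ g j
  cover : ∀ v, (∃ n < m, v = f n) ∨ ∃ n < m, v = g n
  bijOn : Set.BijOn β (Set.Iio m) (Set.Iio m)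
  map_zero : β 0 = 0
  matching_adj : ∀ i < m, M.Adj (f i) (g (β i))
  fst_adj : ∀ n, G.Adj (f n) (f (n + 1))
  snd_adj : ∀ n, G.Adj (g n) (g (n + 1))
  adj_cases : ∀ u v, G.Adj u v → ¬ M.Adj u v →
    (∃ n, s(u, v) = s(f n, f (n + 1))) ∨ ∃ n, s(u, v) = s(g n, g (n + 1))
  matching_cases : ∀ u v, M.Adj u v → ∃ i < m, s(u, v) = s(f i, g (β i))

/-- Chordlessness forces each matching edge to join the two cycles, so the matching is a bijection
between them; rotating the second cycle normalises it to fix `0`. -/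
theorem IsMarkedPermutationGraph.exists_presentation {V : Type*} {G : SimpleGraph V}
    [G.LocallyFinite] {M : G.Subgraph} (h : IsMarkedPermutationGraph G M) :
    ∃ m f g β, IsPermutationPresentation M m f g β := by
  obtain ⟨-, hM, C, D, hC, hD, hdisj, htop, hCc, hDc⟩ := h
  rw [SimpleGraph.Subgraph.isPerfectMatching_iff] at hM
  have hverts : ∀ v, v ∈ C.verts ∨ v ∈ D.verts := by
    intro v
    have : v ∈ (C ⊔ D).verts := by rw [htop]; trivial
    simpa using this
  have hnot : ∀ {E : (G.deleteEdges M.edgeSet).Subgraph} {u v : V}, E.Adj u v →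
      G.Adj u v ∧ ¬ M.Adj u v := fun h => by simpa using h.adj_sub
  -- A matching edge inside `C` would have to be an edge of `C`, but `C` lives in the graph without
  -- the matching edges.
  have hCD : ∀ u ∈ C.verts, ∀ v, M.Adj u v → v ∈ D.verts := fun u hu v huv =>
    (hverts v).resolve_left fun hv => (hnot (hCc u hu v hv huv.adj_sub)).2 huv
  have hDC : ∀ u ∈ D.verts, ∀ v, M.Adj u v → v ∈ C.verts := fun u hu v huv =>
    (hverts v).resolve_right fun hv => (hnot (hDc u hu v hv huv.adj_sub)).2 huv
  obtain ⟨m, f, hm, hf⟩ := hC.exists_isCyclicEnumeration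
  obtain ⟨l, g', hl, hg'⟩ := hD.exists_isCyclicEnumeration
  have hfC : ∀ n, f n ∈ C.verts := fun n => (hf.2.1 _).2 ⟨n, rfl⟩
  obtain ⟨g, hg, hg0⟩ : ∃ g, IsCyclicEnumeration D l g ∧ M.Adj (f 0) (g 0) := by
    obtain ⟨v, hv, -⟩ := hM (f 0)
    obtain ⟨s, rfl⟩ := (hg'.2.1 v).1 (hCD _ (hfC 0) v hv)
    exact ⟨_, hg'.shift (by omega) s, by simpa using hv⟩
  have hgD : ∀ n, g n ∈ D.verts := fun n => (hg.2.1 _).2 ⟨n, rfl⟩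
  have hβ : ∀ i < m, ∃ j < l, M.Adj (f i) (g j) := by
    intro i hi
    obtain ⟨v, hv, -⟩ := hM (f i)
    obtain ⟨j, hj, rfl⟩ := hg.exists_lt (by omega) (hCD _ (hfC i) v hv)
    exact ⟨j, hj, hv⟩
  have hγ : ∀ j < l, ∃ i < m, M.Adj (f i) (g j) := by
    intro j hj
    obtain ⟨v, hv, -⟩ := hM (g j)
    obtain ⟨i, hi, rfl⟩ := hf.exists_lt (by omega) (hDC _ (hgD j) v hv)
    exact ⟨i, hi, hv.symm⟩
  choose! β hβ1 hβ2 using hβ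
  choose! γ hγ1 hγ2 using hγ
  have hinj : Set.InjOn β (Set.Iio m) := by
    intro i hi j hj hij
    have h1 := hβ2 i hi
    rw [hij] at h1
    exact hf.injOn hi hj ((hM _).unique h1.symm (hβ2 j hj).symm)
  have hinj' : Set.InjOn γ (Set.Iio l) := by
    intro i hi j hj hij
    have h1 := hγ2 i hi
    rw [hij] at h1
    exact hg.injOn hi hj ((hM _).unique h1 (hγ2 j hj))
  -- The matching gives injections both ways, so the cycles have equal length.
  obtain rfl : m = l := by
    refine le_antisymm ?_ ?_
    · simpa using Finset.card_le_card_of_injOn (s := Finset.range m) (t := Finset.range l) β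
        (fun i hi => by simpa using hβ1 i (by simpa using hi)) (by simpa [Set.Iio_def] using hinj)
    · simpa using Finset.card_le_card_of_injOn (s := Finset.range l) (t := Finset.range m) γ
        (fun i hi => by simpa using hγ1 i (by simpa using hi)) (by simpa [Set.Iio_def] using hinj')
  have hβγ : ∀ j < m, β (γ j) = j := fun j hj => hg.injOn (hβ1 _ (hγ1 j hj)) hj
    ((hM _).unique (hβ2 _ (hγ1 j hj)) (hγ2 j hj))
  have hcover : ∀ v, (∃ n < m, v = f n) ∨ ∃ n < m, v = g n := fun v =>
    (hverts v).imp (hf.exists_lt (by omega)) (hg.exists_lt (by omega))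
  refine ⟨m, f, g, β, hm, hf.1, hg.1, ?_, hcover, ⟨fun i hi => hβ1 i hi, hinj, ?_⟩, ?_, hβ2, ?_,
    ?_, ?_, ?_⟩
  · intro i j hij
    exact Set.disjoint_left.1 hdisj (hfC i) (hij ▸ hgD j)
  · exact fun j hj => ⟨γ j, hγ1 j hj, hβγ j hj⟩
  · exact hg.injOn (hβ1 0 (by omega)) (by omega) ((hM _).unique (hβ2 0 (by omega)) hg0)
  · exact fun n => (hnot ((hf.2.2 _ _).2 ⟨n, rfl⟩)).1
  · exact fun n => (hnot ((hg.2.2 _ _).2 ⟨n, rfl⟩)).1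
  · intro u v huv huv'
    have h1 : (C ⊔ D).Adj u v := by
      rw [htop, SimpleGraph.Subgraph.top_adj, SimpleGraph.deleteEdges_adj]
      exact ⟨huv, huv'⟩
    exact (SimpleGraph.Subgraph.sup_adj.1 h1).imp (hf.2.2 u v).1 (hg.2.2 u v).1
  · have key : ∀ i < m, ∀ v, M.Adj (f i) v → s(f i, v) = s(f i, g (β i)) := fun i hi v hv => by
      rw [(hM _).unique hv (hβ2 i hi)]
    intro u v huv
    rcases hcover u with ⟨n, hn, rfl⟩ | ⟨n, hn, rfl⟩
    · exact ⟨n, hn, key n hn v huv⟩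
    · obtain ⟨k, hk, rfl⟩ := hf.exists_lt (by omega) (hDC _ (hgD n) v huv)
      exact ⟨k, hk, by rw [Sym2.eq_swap]; exact key k hk _ huv.symm⟩

namespace IsPermutationPresentation

variable {V : Type*} {G : SimpleGraph V} {M : G.Subgraph} {m : ℕ} {f g : ℕ → V} {β : ℕ → ℕ}

theorem fst_injOn (h : IsPermutationPresentation M m f g β) {i j : ℕ} (hi : i < m) (hj : j < m)
    (hij : f i = f j) : i = j :=
  Nat.ModEq.eq_of_lt_of_lt ((h.fst_eq_iff _ _).1 hij) hi hj

theorem snd_injOn (h : IsPermutationPresentation M m f g β) {i j : ℕ} (hi : i < m) (hj : j < m)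
    (hij : g i = g j) : i = j :=
  Nat.ModEq.eq_of_lt_of_lt ((h.snd_eq_iff _ _).1 hij) hi hj

theorem card_eq [Fintype V] (h : IsPermutationPresentation M m f g β) :
    Fintype.card V = 2 * m := by
  have hb : Function.Bijective
      (Sum.elim (fun i : Fin m => f i) (fun i : Fin m => g i)) := by
    constructor
    · rintro (i | i) (j | j) hij
      · exact congrArg _ (Fin.ext (h.fst_injOn i.2 j.2 hij))
      · exact absurd hij (h.fst_ne_snd _ _)
      · exact absurd hij.symm (h.fst_ne_snd _ _)
      · exact congrArg _ (Fin.ext (h.snd_injOn i.2 j.2 hij))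
    · intro v
      rcases h.cover v with ⟨n, hn, rfl⟩ | ⟨n, hn, rfl⟩
      exacts [⟨.inl ⟨n, hn⟩, rfl⟩, ⟨.inr ⟨n, hn⟩, rfl⟩]
  rw [← Fintype.card_of_bijective hb, Fintype.card_sum, Fintype.card_fin]
  ring

theorem matching_adj_iff (h : IsPermutationPresentation M m f g β) (u v : V) :
    M.Adj u v ↔ ∃ i < m, s(u, v) = s(f i, g (β i)) := by
  refine ⟨h.matching_cases u v, ?_⟩
  rintro ⟨i, hi, huv⟩
  rw [← SimpleGraph.Subgraph.mem_edgeSet, huv]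
  exact h.matching_adj i hi

theorem not_matching_adj_fst (h : IsPermutationPresentation M m f g β) (i j : ℕ) :
    ¬ M.Adj (f i) (f j) := by
  rw [h.matching_adj_iff]
  rintro ⟨k, -, hk⟩
  rcases Sym2.eq_iff.1 hk with hk | hk
  exacts [h.fst_ne_snd _ _ hk.2, h.fst_ne_snd _ _ hk.1]

theorem not_matching_adj_snd (h : IsPermutationPresentation M m f g β) (i j : ℕ) :
    ¬ M.Adj (g i) (g j) := by
  rw [h.matching_adj_iff]
  rintro ⟨k, -, hk⟩
  rcases Sym2.eq_iff.1 hk with hk | hk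
  exacts [h.fst_ne_snd _ _ hk.1.symm, h.fst_ne_snd _ _ hk.2.symm]

/-- Two matching edges that join consecutive vertices at both ends give an `M`-copy of the
4-cycle. -/
theorem exists_isMCopyOfC4 (h : IsPermutationPresentation M m f g β) {i : ℕ} (hi : i + 1 < m)
    (hadj : G.Adj (g (β i)) (g (β (i + 1)))) : ∃ Q : G.Subgraph, IsMCopyOfC4 M Q := by
  have hne : f i ≠ f (i + 1) := (h.fst_adj i).ne
  have hM1 := h.matching_adj i (by omega)
  have hM2 := h.matching_adj (i + 1) hi
  let φ : Fin 4 → V := ![f i, f (i + 1), g (β (i + 1)), g (β i)]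
  have hφ : Function.Injective φ := by
    intro x y hxy
    have e1 := h.fst_ne_snd
    have e2 := hadj.ne
    fin_cases x <;> fin_cases y <;> simp_all [φ, hne.symm, e2.symm, fun a b => (e1 a b).symm]
  have hadjφ : ∀ x y, (SimpleGraph.cycleGraph 4).Adj x y → G.Adj (φ x) (φ y) := by
    have hstep : ∀ x, G.Adj (φ x) (φ (x + 1)) := by
      intro x
      fin_cases x
      exacts [h.fst_adj i, hM2.adj_sub, hadj.symm, hM1.adj_sub.symm]
    intro x y hxy
    rw [SimpleGraph.cycleGraph_adj, sub_eq_iff_eq_add', sub_eq_iff_eq_add'] at hxy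
    rcases hxy with rfl | rfl
    · exact (hstep y).symm
    · exact hstep x
  let c : SimpleGraph.Copy (SimpleGraph.cycleGraph 4) G := ⟨⟨φ, hadjφ _ _⟩, hφ⟩
  refine ⟨c.toSubgraph, ⟨c.isoToSubgraph⟩, ?_⟩
  have : c.toSubgraph.edgeSet ∩ M.edgeSet =
      {s(f (i + 1), g (β (i + 1))), s(g (β i), f i)} := by
    have hstep : ∀ x, M.Adj (φ x) (φ (x + 1)) →
        s(φ x, φ (x + 1)) ∈ ({s(f (i + 1), g (β (i + 1))), s(g (β i), f i)} : Set (Sym2 V)) := by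
      intro x hx
      fin_cases x
      · exact absurd hx (h.not_matching_adj_fst _ _)
      · exact Or.inl rfl
      · exact absurd hx (h.not_matching_adj_snd _ _)
      · exact Or.inr rfl
    apply Set.Subset.antisymm
    · intro e
      induction e with | _ u v
      rintro ⟨⟨x, y, hxy, rfl, rfl⟩, hM⟩
      replace hM : M.Adj (φ x) (φ y) := hM
      rw [SimpleGraph.Subgraph.top_adj, SimpleGraph.cycleGraph_adj, sub_eq_iff_eq_add',
        sub_eq_iff_eq_add'] at hxy
      rcases hxy with rfl | rfl
      · exact (congrArg (· ∈ _) Sym2.eq_swap).mp (hstep y hM.symm)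
      · exact hstep x hM
    · rintro e (rfl | rfl)
      · exact ⟨⟨1, 2, SimpleGraph.cycleGraph_adj.2 (by decide), rfl, rfl⟩, hM2⟩
      · exact ⟨⟨3, 0, SimpleGraph.cycleGraph_adj.2 (by decide), rfl, rfl⟩, hM1.symm⟩
  rw [this, Set.ncard_pair]
  intro hh
  rcases Sym2.eq_iff.1 hh with hh | hh
  exacts [h.fst_ne_snd _ _ hh.1, hne hh.1.symm]

end IsPermutationPresentation

/-- Adding `m` to the entries that come after the wrap-around makes the sequence increase within a
single turn. -/
theorem CyclicallyOrdered.exists_lift {c : Fin 5 → ℕ} {m : ℕ}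
    (h : CyclicallyOrdered (c 0) (c 1) (c 2) (c 3) (c 4)) (hm : ∀ i, c i < m) :
    ∃ a : Fin 5 → ℕ, (a 0 < a 1 ∧ a 1 < a 2 ∧ a 2 < a 3 ∧ a 3 < a 4 ∧ a 4 < a 0 + m) ∧
      ∀ i, a i ≡ c i [MOD m] := by
  have h0 := hm 0
  have h1 := hm 1
  have h2 := hm 2
  have h3 := hm 3
  have h4 := hm 4
  let a : (Fin 5 → ℕ) → Fin 5 → ℕ := fun s i => c i + s i * m
  have ha : ∀ s i, a s i ≡ c i [MOD m] := fun s i => by simp [a, Nat.ModEq]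
  rcases h with h | h | h | h | h
  · exact ⟨a ![0, 0, 0, 0, 0], by simp [a]; omega, ha _⟩
  · exact ⟨a ![0, 1, 1, 1, 1], by simp [a]; omega, ha _⟩
  · exact ⟨a ![0, 0, 1, 1, 1], by simp [a]; omega, ha _⟩
  · exact ⟨a ![0, 0, 0, 1, 1], by simp [a]; omega, ha _⟩
  · exact ⟨a ![0, 0, 0, 0, 1], by simp [a]; omega, ha _⟩

/-! ### From pentagrams to copies of the Petersen graph -/

/-- The spanning subgraph of `G` whose edges are those outside `M` and the matching edges of `f i`
with `g (β i)` for `i` in `S`. -/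
def subgraphOfMatchingSubset {V : Type*} {G : SimpleGraph V} (M : G.Subgraph) (f g : ℕ → V)
    (β : ℕ → ℕ) (S : Finset ℕ) : G.Subgraph where
  verts := Set.univ
  Adj u v := G.Adj u v ∧ (M.Adj u v → ∃ i ∈ S, s(u, v) = s(f i, g (β i)))
  adj_sub h := h.1
  edge_vert _ := trivial
  symm := ⟨fun u v h => ⟨h.1.symm, fun h' => by rw [Sym2.eq_swap]; exact h.2 h'.symm⟩⟩

namespace IsPermutationPresentation

variable {V : Type*} {G : SimpleGraph V} {M : G.Subgraph} {m : ℕ} {f g : ℕ → V} {β : ℕ → ℕ}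

theorem isSubdivisionOf_of_isPentagram (h : IsPermutationPresentation M m f g β) {q : Fin 5 → ℕ}
    (hq : IsPentagram β (q 0) (q 1) (q 2) (q 3) (q 4)) (hqm : ∀ i, q i < m) {S : Finset ℕ}
    (hS : ∀ x, x ∈ S ↔ ∃ i, x = q i) :
    IsSubdivisionOf (subgraphOfMatchingSubset M f g β S).coe petersenGraph := by
  obtain ⟨a, ha, haq⟩ := hq.1.exists_lift hqm
  -- The `j`-th point in the order of values is `q (t * j)`; the two directions of the star are `t =
  -- 2` and `t = 3`.
  obtain ⟨t, ht, b, hb, hbq⟩ : ∃ t : Fin 5, (t = 2 ∨ t = 3) ∧ ∃ b : Fin 5 → ℕ,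
      (b 0 < b 1 ∧ b 1 < b 2 ∧ b 2 < b 3 ∧ b 3 < b 4 ∧ b 4 < b 0 + m) ∧
      ∀ j, b j ≡ β (q (t * j)) [MOD m] := by
    rcases hq.2 with h' | h'
    · exact ⟨2, Or.inl rfl, CyclicallyOrdered.exists_lift (c := fun j => β (q (2 * j))) h'
        fun j => h.bijOn.mapsTo (hqm _)⟩
    · exact ⟨3, Or.inr rfl, CyclicallyOrdered.exists_lift (c := fun j => β (q (3 * j))) h'
        fun j => h.bijOn.mapsTo (hqm _)⟩
  have ef : ∀ i, f (a i) = f (q i) := fun i => (h.fst_eq_iff _ _).2 (haq i)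
  have eg : ∀ j, g (b j) = g (β (q (t * j))) := fun j => (h.snd_eq_iff _ _).2 (hbq j)
  refine isSubdivisionOf_petersenGraph (f := fun n => ⟨f n, trivial⟩) (g := fun n => ⟨g n, trivial⟩)
    (m := m) ?_ ?_ ?_ ?_ ?_ ?_ ha hb ht ?_ ?_
  · exact fun n => ⟨h.fst_adj n, fun h' => absurd h' (h.not_matching_adj_fst _ _)⟩
  · exact fun i j => Subtype.mk_eq_mk.trans (h.fst_eq_iff i j)
  · exact fun n => ⟨h.snd_adj n, fun h' => absurd h' (h.not_matching_adj_snd _ _)⟩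
  · exact fun i j => Subtype.mk_eq_mk.trans (h.snd_eq_iff i j)
  · exact fun i j hij => h.fst_ne_snd i j (congrArg Subtype.val hij)
  · rintro ⟨u, hu⟩
    rcases h.cover u with ⟨n, -, rfl⟩ | ⟨n, -, rfl⟩
    exacts [Or.inl ⟨n, rfl⟩, Or.inr ⟨n, rfl⟩]
  · intro j
    change (subgraphOfMatchingSubset M f g β S).Adj (f (a (t * j))) (g (b j))
    rw [ef, eg]
    exact ⟨(h.matching_adj _ (hqm _)).adj_sub, fun _ => ⟨_, (hS _).2 ⟨_, rfl⟩, rfl⟩⟩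
  · rintro ⟨u, hu⟩ ⟨v, hv⟩ ⟨huv, huv'⟩
    have lift : ∀ {x y : V}, s(u, v) = s(x, y) →
        s((⟨u, hu⟩ : (subgraphOfMatchingSubset M f g β S).verts), ⟨v, hv⟩) =
          s(⟨x, trivial⟩, ⟨y, trivial⟩) := by
      intro x y hxy
      rcases Sym2.eq_iff.1 hxy with ⟨rfl, rfl⟩ | ⟨rfl, rfl⟩
      exacts [rfl, Sym2.eq_swap]
    by_cases hM : M.Adj u v
    · obtain ⟨i, hi, hi'⟩ := huv' hM
      obtain ⟨k, rfl⟩ := (hS i).1 hi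
      -- 2 and 3 are invertible modulo 5, so every chosen matching edge is one of the spokes.
      have hdiv : ∀ k : Fin 5, ∃ j, k = t * j := by
        clear hbq eg lift hi hi'
        rcases ht with rfl | rfl <;> decide
      obtain ⟨j, rfl⟩ := hdiv k
      rw [← ef, ← eg] at hi'
      exact Or.inr (Or.inr ⟨j, lift hi'⟩)
    · rcases h.adj_cases u v huv hM with ⟨n, hn⟩ | ⟨n, hn⟩
      exacts [Or.inl ⟨n, lift hn⟩, Or.inr (Or.inl ⟨n, lift hn⟩)]

theorem matching_edge_injOn (h : IsPermutationPresentation M m f g β) {i j : ℕ} (hi : i < m)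
    (hj : j < m) (hij : s(f i, g (β i)) = s(f j, g (β j))) : i = j := by
  rcases Sym2.eq_iff.1 hij with h' | h'
  · exact h.fst_injOn hi hj h'.1
  · exact absurd h'.1 (h.fst_ne_snd _ _)

theorem isMCopyOfPetersen (h : IsPermutationPresentation M m f g β) {S : Finset ℕ}
    (hS : IsPentagramSet β S) (hSm : S ⊆ Finset.range m) :
    IsMCopyOfPetersen M (subgraphOfMatchingSubset M f g β S) := by
  have hlt : ∀ i ∈ S, i < m := fun i hi => Finset.mem_range.1 (hSm hi)
  refine ⟨?_, rfl, (fun i => s(f i, g (β i))) '' S, ?_, ?_, ?_⟩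
  · obtain ⟨a, b, c, d, e, rfl, hq⟩ := hS
    refine h.isSubdivisionOf_of_isPentagram (q := ![a, b, c, d, e]) hq ?_ ?_
    · intro i
      apply hlt
      fin_cases i <;> simp
    · intro x
      simp [Fin.exists_fin_succ]
  · rintro - ⟨i, hi, rfl⟩
    exact h.matching_adj i (hlt i hi)
  · have hinj : Set.InjOn (fun i => s(f i, g (β i))) S :=
      fun i hi j hj hij => h.matching_edge_injOn (hlt i hi) (hlt j hj) hij
    rw [hinj.ncard_image, Set.ncard_coe_finset, hS.card]
  · ext e
    induction e with | _ u v
    constructor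
    · rintro ⟨huv, huv'⟩
      by_cases hM : M.Adj u v
      · obtain ⟨i, hi, hi'⟩ := huv' hM
        exact Or.inr ⟨i, hi, hi'.symm⟩
      · exact Or.inl ⟨huv, hM⟩
    · rintro (⟨huv, hM⟩ | ⟨i, hi, hi'⟩)
      · exact ⟨huv, fun h' => absurd h' hM⟩
      · exact ⟨((h.matching_adj_iff u v).2 ⟨i, hlt i hi, hi'.symm⟩).adj_sub,
          fun _ => ⟨i, hi, hi'.symm⟩⟩

/-- Recovers `S` from its subgraph, so that distinct pentagrams are counted as distinct copies. -/
theorem subgraphOfMatchingSubset_adj_iff (h : IsPermutationPresentation M m f g β) {S : Finset ℕ}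
    (hSm : S ⊆ Finset.range m) {i : ℕ} (hi : i < m) :
    (subgraphOfMatchingSubset M f g β S).Adj (f i) (g (β i)) ↔ i ∈ S := by
  constructor
  · rintro ⟨-, h'⟩
    obtain ⟨j, hj, hij⟩ := h' (h.matching_adj i hi)
    rwa [h.matching_edge_injOn hi (Finset.mem_range.1 (hSm hj)) hij]
  · exact fun h' => ⟨(h.matching_adj i hi).adj_sub, fun _ => ⟨i, h', rfl⟩⟩

end IsPermutationPresentation

theorem propositionp {V : Type*} [Fintype V] (G : SimpleGraph V) [G.LocallyFinite]
    (M : G.Subgraph) (hGM : IsMarkedPermutationGraph G M) (hn : 40 ≤ Fintype.card V)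
    (hC4 : ¬ ∃ Q : G.Subgraph, IsMCopyOfC4 M Q) :
    (Fintype.card V : ℝ) / 2 - 4 ≤
      ({Q : G.Subgraph | IsMCopyOfPetersen M Q}.ncard : ℝ) := by
  obtain ⟨m, f, g, β, h⟩ := hGM.exists_presentation
  -- Consecutive values at consecutive points would be adjacent on `g`, and so complete an `M`-copy
  -- of the 4-cycle.
  obtain ⟨S, hS, hSm⟩ := exists_isPentagramSet h.three_le h.bijOn h.map_zero fun i hi =>
    ⟨fun h' => hC4 (h.exists_isMCopyOfC4 hi (h' ▸ h.snd_adj _)),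
      fun h' => hC4 (h.exists_isMCopyOfC4 hi (h' ▸ (h.snd_adj _).symm))⟩
  obtain ⟨F, hF, hF'⟩ := hS.exists_family h.bijOn.injOn hSm
  have hcard : F.card ≤ {Q : G.Subgraph | IsMCopyOfPetersen M Q}.ncard := by
    rw [← Set.ncard_coe_finset]
    -- Finiteness of the set of copies matters here, because `ncard` is zero on infinite sets.
    refine Set.ncard_le_ncard_of_injOn (subgraphOfMatchingSubset M f g β)
      (fun T hT => h.isMCopyOfPetersen (hF' T hT).1 (hF' T hT).2) ?_ (Set.toFinite _)
    intro T hT T' hT' hTT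
    have hT := (hF' T hT).2
    have hT' := (hF' T' hT').2
    ext i
    by_cases hi : i < m
    · rw [← h.subgraphOfMatchingSubset_adj_iff hT hi, hTT,
        h.subgraphOfMatchingSubset_adj_iff hT' hi]
    · exact iff_of_false (fun h' => hi (Finset.mem_range.1 (hT h')))
        (fun h' => hi (Finset.mem_range.1 (hT' h')))
  have hm : m ≤ {Q : G.Subgraph | IsMCopyOfPetersen M Q}.ncard + 4 := by omega
  have hm' : (m : ℝ) ≤ {Q : G.Subgraph | IsMCopyOfPetersen M Q}.ncard + 4 := by exact_mod_cast hm
  rw [h.card_eq]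
  push_cast
  linarith
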